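/- There exists an absolute constant $C>0$ such that the following holds. Let $k, w \ge 1$ be integers and let $G = (L, R, E)$ be a bipartite graph (with vertex set the disjoint union $L \sqcup R$ and every edge joining $L$ to $R$) that is $w$-left-regular (every vertex in $L$ has exactly $w$ neighbors), has no isolated vertices, and is such that no two distinct vertices in $L$ have the same neighborhood. A set of edges $M \subseteq E$ is called an induced matching of $G$ if (i) $M$ is a matching, i.e. no two distinct edges of $M$ share a vertex, and (ii) no edge of $G$ connects endpoints of two distinct edges of $M$. If $G$ has no induced matching of size $k$, then $L$ is finite and \[ |L| \leq \begin{cases} \left(C \cdot \frac{k}{w}\right)^w & \text{if } w \leq k, \\[2pt] \left(C \cdot \frac{w}{k}\right)^k & \text{if } w \geq k. \end{cases} \] -/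

import Mathlib

/-- A set `M` of edges of `G` is an induced matching if (i) distinct edges of `M` share no vertex and
(ii) no edge of `G` connects endpoints of two distinct edges of `M`. -/
def SimpleGraph.IsInducedMatching {V : Type*} (G : SimpleGraph V) (M : Set (Sym2 V)) : Prop :=
  M ⊆ G.edgeSet ∧
    (∀ e ∈ M, ∀ f ∈ M, e ≠ f → ∀ v, v ∈ e → v ∉ f) ∧
    (∀ e ∈ M, ∀ f ∈ M, e ≠ f → ∀ u ∈ e, ∀ v ∈ f, ¬ G.Adj u v)

/-! Take a finite `T ⊆ L` with neighborhoods `A v`. They are distinct of equal size, so none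
contains another, and some minimal `B v` misses `A v` but meets every other `A u`. By minimality
each point of `B v` is the only point of `B v` in some `A u`; these edges form an induced matching,
so `B v` has at most `k` points. The weighted set-pair inequality then bounds `T.card` uniformly,
which also gives finiteness of `L`. -/

/-- Weighted set-pair inequality: if `A i` and `B j` are disjoint exactly when `i = j`, then the
events "a `p`-random set contains `A i` and avoids `B i`" are pairwise incompatible. -/
theorem Finset.card_mul_pow_mul_pow_le_one_of_setPairs {ι α : Type*} [DecidableEq α]
    (T : Finset ι) (A B : ι → Finset α) (w k : ℕ) (p q : ℝ) (hp : 0 ≤ p) (hq : 0 ≤ q)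
    (hpq : p + q = 1) (hA : ∀ i ∈ T, (A i).card = w) (hB : ∀ i ∈ T, (B i).card ≤ k)
    (hdisj : ∀ i ∈ T, Disjoint (A i) (B i))
    (hmeet : ∀ i ∈ T, ∀ j ∈ T, i ≠ j → ¬ Disjoint (A i) (B j)) :
    (T.card : ℝ) * (p ^ w * q ^ k) ≤ 1 := by
  classical
  have hq1 : q ≤ 1 := by linarith
  set U : Finset α := T.biUnion fun i => A i ∪ B i
  have hterm : ∀ i ∈ T, p ^ w * q ^ k ≤
      ∑ S ∈ U.powerset, if A i ⊆ S ∧ Disjoint (B i) S then p ^ S.card * q ^ (U \ S).card else 0 := by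
    intro i hi
    have hAU : A i ⊆ U := fun x hx =>
      Finset.mem_biUnion.2 ⟨i, hi, Finset.mem_union_left _ hx⟩
    have hBU : B i ⊆ U := fun x hx =>
      Finset.mem_biUnion.2 ⟨i, hi, Finset.mem_union_right _ hx⟩
    -- Expanding the product sums over random sets `S`: the first summand puts `x` in `S`, the
    -- second leaves it out, and the zeros kill forbidden choices.
    have hprod : ∏ x ∈ U, ((if x ∈ B i then 0 else p) + (if x ∈ A i then 0 else q)) =
        p ^ (A i).card * q ^ (B i).card := by
      have hpt : ∀ x ∈ U, ((if x ∈ B i then 0 else p) + (if x ∈ A i then 0 else q)) =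
          (if x ∈ A i then p else 1) * (if x ∈ B i then q else 1) := by
        intro x _
        by_cases hxA : x ∈ A i
        · have hxB : x ∉ B i := Finset.disjoint_left.1 (hdisj i hi) hxA
          simp [hxA, hxB]
        · by_cases hxB : x ∈ B i <;> simp [hxA, hxB, hpq]
      rw [Finset.prod_congr rfl hpt, Finset.prod_mul_distrib, Finset.prod_ite_mem,
        Finset.prod_ite_mem, Finset.inter_eq_right.2 hAU, Finset.inter_eq_right.2 hBU,
        Finset.prod_const, Finset.prod_const]
    calc p ^ w * q ^ k ≤ p ^ (A i).card * q ^ (B i).card := by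
          rw [hA i hi]
          exact mul_le_mul_of_nonneg_left (pow_le_pow_of_le_one hq hq1 (hB i hi)) (by positivity)
      _ = _ := by
          rw [← hprod, Finset.prod_add]
          refine Finset.sum_congr rfl fun S hS => ?_
          split_ifs with h
          · rw [← Finset.prod_const, ← Finset.prod_const]
            congr 1
            · refine Finset.prod_congr rfl fun x hx => ?_
              rw [if_neg fun hxB => Finset.disjoint_left.1 h.2 hxB hx]
            · refine Finset.prod_congr rfl fun x hx => ?_
              rw [if_neg fun hxA => (Finset.mem_sdiff.1 hx).2 (h.1 hxA)]
          · rw [not_and_or, Finset.not_subset, Finset.not_disjoint_iff] at h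
            rcases h with ⟨x, hxA, hxS⟩ | ⟨x, hxB, hxS⟩
            · refine mul_eq_zero_of_right _ (Finset.prod_eq_zero (i := x) ?_ (if_pos hxA))
              exact Finset.mem_sdiff.2 ⟨hAU hxA, hxS⟩
            · apply mul_eq_zero_of_left
              apply Finset.prod_eq_zero hxS
              exact if_pos hxB
  calc (T.card : ℝ) * (p ^ w * q ^ k) = ∑ i ∈ T, p ^ w * q ^ k := by
        rw [Finset.sum_const, nsmul_eq_mul]
    _ ≤ _ := Finset.sum_le_sum hterm
    _ = _ := Finset.sum_comm
    _ ≤ ∑ S ∈ U.powerset, p ^ S.card * q ^ (U \ S).card := by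
        refine Finset.sum_le_sum fun S _ => ?_
        by_cases h : ∃ i ∈ T, A i ⊆ S ∧ Disjoint (B i) S
        · obtain ⟨i, hi, hAS, hBS⟩ := h
          rw [Finset.sum_eq_single_of_mem i hi, if_pos ⟨hAS, hBS⟩]
          -- If `S` also served `j`, then `A i ⊆ S` would be disjoint from `B j`.
          intro j hj hji
          exact if_neg fun h => hmeet i hi j hj hji.symm (h.2.symm.mono_left hAS)
        · rw [Finset.sum_eq_zero fun i hi => if_neg fun hS => h ⟨i, hi, hS⟩]
          positivity
    _ = 1 := by
        have := Finset.prod_add (fun _ : α => p) (fun _ => q) U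
        simp only [hpq, Finset.prod_const_one, Finset.prod_const] at this
        exact this.symm

/-- Minimal transversals: each point of a minimal transversal has a private set. -/
theorem Finset.exists_disjoint_transversal_private {ι α : Type*} [DecidableEq α]
    (T : Finset ι) (A : ι → Finset α) (i : ι) (h : ∀ j ∈ T, j ≠ i → ¬ A j ⊆ A i) :
    ∃ B : Finset α, Disjoint (A i) B ∧ (∀ j ∈ T, j ≠ i → ¬ Disjoint (A j) B) ∧
      ∀ x ∈ B, ∃ j ∈ T, ∀ y ∈ B, y ∈ A j ↔ y = x := by
  classical
  obtain ⟨B, -, hB⟩ := exists_minimal_le_of_wellFoundedLT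
    (fun B : Finset α => Disjoint (A i) B ∧ ∀ j ∈ T, j ≠ i → ¬ Disjoint (A j) B)
    (T.biUnion A \ A i) ⟨Finset.disjoint_sdiff, fun j hj hji => by
      obtain ⟨x, hxj, hxi⟩ := Finset.not_subset.1 (h j hj hji)
      exact Finset.not_disjoint_iff.2
        ⟨x, hxj, Finset.mem_sdiff.2 ⟨Finset.mem_biUnion.2 ⟨j, hj, hxj⟩, hxi⟩⟩⟩
  refine ⟨B, hB.prop.1, hB.prop.2, fun x hx => ?_⟩
  have hnot := hB.not_prop_of_lt (Finset.erase_ssubset hx)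
  -- Erasing `x` keeps disjointness from `A i`, so some `A j` must be lost: it meets `B` only at
  -- `x`.
  simp only [not_and, not_forall, not_not] at hnot
  obtain ⟨j, hj, hji, hd⟩ := hnot (hB.prop.1.mono_right (Finset.erase_subset _ _))
  have honly : ∀ y ∈ B, y ∈ A j → y = x := fun y hy hyj => by
    by_contra hyx
    exact Finset.disjoint_left.1 hd hyj (Finset.mem_erase.2 ⟨hyx, hy⟩)
  obtain ⟨z, hzj, hzB⟩ := Finset.not_disjoint_iff.1 (hB.prop.2 j hj hji)
  refine ⟨j, hj, fun y hy => ⟨honly y hy, ?_⟩⟩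
  rintro rfl
  exact honly z hzB hzj ▸ hzj

theorem SimpleGraph.IsBipartiteWith.exists_isInducedMatching {V : Type*} {G : SimpleGraph V}
    {L R : Set V} (hG : G.IsBipartiteWith L R) (B : Finset V) (f : V → V)
    (hf : ∀ x ∈ B, f x ∈ L) (hfB : ∀ x ∈ B, ∀ y ∈ B, G.Adj (f x) y ↔ y = x) :
    ∃ M : Set (Sym2 V), G.IsInducedMatching M ∧ M.encard = B.card := by
  have hadj : ∀ x ∈ B, G.Adj (f x) x := fun x hx => (hfB x hx x hx).2 rfl
  have hR : ∀ x ∈ B, x ∈ R := fun x hx => hG.mem_of_mem_adj (hf x hx) (hadj x hx)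
  have hLR : ∀ v, v ∈ L → v ∉ R := fun v hv =>
    Set.disjoint_left.1 hG.disjoint hv
  have hinj : ∀ x ∈ B, ∀ y ∈ B, f x = f y → x = y := fun x hx y hy h =>
    (hfB y hy x hx).1 (h ▸ hadj x hx)
  have hne : ∀ x ∈ B, ∀ y ∈ B, f x ≠ y := fun x hx y hy h => hLR _ (hf x hx) (h ▸ hR y hy)
  refine ⟨(fun x => s(f x, x)) '' (B : Set V), ⟨?_, ?_, ?_⟩, ?_⟩
  · rintro _ ⟨x, hx, rfl⟩
    exact hadj x hx
  · rintro _ ⟨x, hx, rfl⟩ _ ⟨y, hy, rfl⟩ hxy v hv hv'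
    have hxy' : x ≠ y := fun h => hxy (h ▸ rfl)
    rcases Sym2.mem_iff.1 hv with rfl | rfl <;> rcases Sym2.mem_iff.1 hv' with h | h
    · exact hxy' (hinj x hx y hy h)
    · exact hne x hx y hy h
    · exact hne y hy _ hx h.symm
    · exact hxy' h
  · rintro _ ⟨x, hx, rfl⟩ _ ⟨y, hy, rfl⟩ hxy u hu v hv huv
    have hxy' : x ≠ y := fun h => hxy (h ▸ rfl)
    rcases Sym2.mem_iff.1 hu with rfl | rfl <;> rcases Sym2.mem_iff.1 hv with rfl | rfl
    · exact hLR _ (hf y hy) (hG.mem_of_mem_adj (hf x hx) huv)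
    · exact hxy' ((hfB x hx _ hy).1 huv).symm
    · exact hxy' ((hfB y hy _ hx).1 huv.symm)
    · exact hLR _ (hG.symm.mem_of_mem_adj (hR _ hx) huv) (hR _ hy)
  · rw [Set.InjOn.encard_image, Set.encard_coe_eq_coe_finsetCard]
    intro x hx y hy h
    rcases Sym2.eq_iff.1 h with h | h
    · exact h.2
    · exact (hne x hx y hy h.1).elim

theorem SimpleGraph.IsBipartiteWith.card_mul_pow_mul_pow_le_one {V : Type*} {G : SimpleGraph V}
    {L R : Set V} (hG : G.IsBipartiteWith L R) {k w : ℕ}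
    (hw : ∀ v ∈ L, (G.neighborSet v).encard = w)
    (hinj : ∀ u ∈ L, ∀ v ∈ L, G.neighborSet u = G.neighborSet v → u = v)
    (hM : ¬ ∃ M : Set (Sym2 V), G.IsInducedMatching M ∧ M.encard = k)
    (p q : ℝ) (hp : 0 ≤ p) (hq : 0 ≤ q) (hpq : p + q = 1) (T : Finset V) (hT : (T : Set V) ⊆ L) :
    (T.card : ℝ) * (p ^ w * q ^ k) ≤ 1 := by
  classical
  have hex : ∀ v, ∃ A : Finset V, v ∈ L → (A : Set V) = G.neighborSet v ∧ A.card = w := by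
    intro v
    by_cases hv : v ∈ L
    · have hfin : (G.neighborSet v).Finite := Set.finite_of_encard_eq_coe (hw v hv)
      refine ⟨hfin.toFinset, fun _ => ⟨hfin.coe_toFinset, ?_⟩⟩
      have := hw v hv
      rw [hfin.encard_eq_coe_toFinset_card] at this
      exact_mod_cast this
    · exact ⟨∅, fun h => (hv h).elim⟩
  choose A hA using hex
  have hmemA : ∀ v ∈ L, ∀ x, x ∈ A v ↔ G.Adj v x := fun v hv x => by
    rw [← Finset.mem_coe, (hA v hv).1, SimpleGraph.mem_neighborSet]
  have htrans : ∀ v, ∃ B : Finset V, v ∈ T → Disjoint (A v) B ∧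
      (∀ u ∈ T, u ≠ v → ¬ Disjoint (A u) B) ∧ B.card ≤ k := by
    intro v
    by_cases hv : v ∈ T
    swap
    · exact ⟨∅, fun h => (hv h).elim⟩
    obtain ⟨B, hB, hmeet, hpriv⟩ := T.exists_disjoint_transversal_private A v (by
      intro u hu huv hsub
      have heq := Finset.eq_of_subset_of_card_le hsub (by
        rw [(hA u (hT hu)).2, (hA v (hT hv)).2])
      exact huv (hinj u (hT hu) v (hT hv) (by rw [← (hA u (hT hu)).1, heq, (hA v (hT hv)).1])))
    refine ⟨B, fun _ => ⟨hB, hmeet, ?_⟩⟩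
    by_contra! hk
    -- Privacy passes to subsets, so the matching can be cut to size exactly `k`.
    obtain ⟨B', hB', hcard⟩ := Finset.exists_subset_card_eq hk.le
    have hf : ∀ x, ∃ u, x ∈ B → u ∈ T ∧ ∀ y ∈ B, y ∈ A u ↔ y = x := by
      intro x
      by_cases hx : x ∈ B
      · obtain ⟨u, hu⟩ := hpriv x hx
        exact ⟨u, fun _ => hu⟩
      · exact ⟨x, fun h => (hx h).elim⟩
    choose f hf using hf
    refine hM (hcard ▸ hG.exists_isInducedMatching B' f (fun x hx => hT (hf x (hB' hx)).1) ?_)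
    intro x hx y hy
    rw [← hmemA _ (hT (hf x (hB' hx)).1)]
    exact (hf x (hB' hx)).2 y (hB' hy)
  choose B hB using htrans
  exact T.card_mul_pow_mul_pow_le_one_of_setPairs A B w k p q hp hq hpq
    (fun v hv => (hA v (hT hv)).2) (fun v hv => (hB v hv).2.2) (fun v hv => (hB v hv).1)
    (fun u hu v hv huv => (hB v hv).2.1 u hu huv)

/-- The constant is 6 = 2 · 3: 1 ≤ b/a gives the 2, and 1 + x ≤ exp x with e < 3 gives the 3. -/
theorem one_add_div_pow_mul_one_add_div_pow_le {a b : ℕ} (ha : 1 ≤ a) (hab : a ≤ b) :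
    (1 + (b : ℝ) / a) ^ a * (1 + (a : ℝ) / b) ^ b ≤ (6 * ((b : ℝ) / a)) ^ a := by
  have ha' : (0 : ℝ) < a := by exact_mod_cast ha
  have hab' : (a : ℝ) ≤ b := by exact_mod_cast hab
  have hb' : (0 : ℝ) < b := ha'.trans_le hab'
  have h1 : 1 + (b : ℝ) / a ≤ 2 * (b / a) := by
    have : 1 ≤ (b : ℝ) / a := (one_le_div ha').2 hab'
    linarith
  have h2 : (1 + (a : ℝ) / b) ^ b ≤ 3 ^ a := by
    calc (1 + (a : ℝ) / b) ^ b ≤ Real.exp (a / b) ^ b := by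
          gcongr
          rw [add_comm]
          exact Real.add_one_le_exp _
      _ = Real.exp 1 ^ a := by
          rw [← Real.exp_nat_mul, ← Real.exp_nat_mul]
          congr 1
          field_simp
      _ ≤ 3 ^ a := by
          gcongr
          exact Real.exp_one_lt_three.le
  calc (1 + (b : ℝ) / a) ^ a * (1 + (a : ℝ) / b) ^ b ≤ (2 * (b / a)) ^ a * 3 ^ a := by gcongr
    _ = (6 * ((b : ℝ) / a)) ^ a := by
        rw [← mul_pow]
        ring

theorem corollary1p5 :
    ∃ C : ℝ, 0 < C ∧
      ∀ (k w : ℕ), 1 ≤ k → 1 ≤ w →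
      ∀ (V : Type*) (G : SimpleGraph V) (L R : Set V),
        G.IsBipartiteWith L R → L ∪ R = Set.univ →
        (∀ v ∈ L, (G.neighborSet v).encard = w) →
        (∀ v, ∃ u, G.Adj v u) →
        (∀ u ∈ L, ∀ v ∈ L, G.neighborSet u = G.neighborSet v → u = v) →
        (¬ ∃ M : Set (Sym2 V), G.IsInducedMatching M ∧ M.encard = k) →
        L.Finite ∧
          (w ≤ k → (L.ncard : ℝ) ≤ (C * ((k : ℝ) / (w : ℝ))) ^ w) ∧
          (k ≤ w → (L.ncard : ℝ) ≤ (C * ((w : ℝ) / (k : ℝ))) ^ k) := by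
  refine ⟨6, by norm_num, fun k w hk hw V G L R hG _ hdeg _ hinj hM => ?_⟩
  have hk' : (0 : ℝ) < k := by exact_mod_cast hk
  have hw' : (0 : ℝ) < w := by exact_mod_cast hw
  have hbound : ∀ T : Finset V, (T : Set V) ⊆ L →
      (T.card : ℝ) ≤ (1 + (k : ℝ) / w) ^ w * (1 + (w : ℝ) / k) ^ k := by
    intro T hT
    -- Here p = w/(w+k) and q = k/(w+k), the maximizer of p^w q^k.
    have h := hG.card_mul_pow_mul_pow_le_one hdeg hinj hM (1 + (k : ℝ) / w)⁻¹
      (1 + (w : ℝ) / k)⁻¹ (by positivity) (by positivity) (by field_simp; ring) T hT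
    rwa [inv_pow, inv_pow, ← mul_inv, ← div_eq_mul_inv, div_le_one (by positivity)] at h
  have hfin : L.Finite := by
    by_contra hinf
    obtain ⟨n, hn⟩ := exists_nat_gt ((1 + (k : ℝ) / w) ^ w * (1 + (w : ℝ) / k) ^ k)
    obtain ⟨T, hT, hcard⟩ := Set.Infinite.exists_subset_card_eq hinf n
    exact absurd (hbound T hT) (by rw [hcard]; exact hn.not_ge)
  have hL : (L.ncard : ℝ) ≤ (1 + (k : ℝ) / w) ^ w * (1 + (w : ℝ) / k) ^ k := by
    rw [Set.ncard_eq_toFinset_card L hfin]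
    exact hbound _ hfin.coe_toFinset.subset
  refine ⟨hfin, fun hwk => hL.trans (one_add_div_pow_mul_one_add_div_pow_le hw hwk),
    fun hkw => hL.trans ?_⟩
  rw [mul_comm]
  exact one_add_div_pow_mul_one_add_div_pow_le hk hkw
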